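/- For an integer $n\ge 0$, let $p_\nu(n)$ denote the number of partitions of $n$ into one or more distinct non-negative integer parts (so the part $0$ is allowed, at most once) in which every odd part is less than twice the smallest part, and let $\mathrm{spt}_\nu(n)$ denote the total number of appearances of the smallest part, over all partitions counted by $p_\nu(n)$. Let $$\nu(q)=\sum_{n=0}^{\infty}\frac{q^{n^2+n}}{(-q;q^2)_{n+1}},\qquad (a;q)_n=\prod_{j=0}^{n-1}(1-aq^j),$$ be the third order mock theta function $\nu$, regarded as a formal power series in $q$ with integer coefficients. Then for every integer $n\ge 0$, $$\mathrm{spt}_\nu(10n+8)=p_\nu(10n+8)\equiv 0\pmod 5,$$ and the coefficient of $q^{10n+8}$ in $\nu(-q)$ is divisible by $5$. -/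

import Mathlib

/-- The smallest element of a multiset of natural numbers (`0` for the empty multiset). -/
noncomputable def smallestPart (π : Multiset ℕ) : ℕ := sInf {i | i ∈ π}

/-- `π` is a partition of `n` into distinct non-negative parts (the part `0` may occur, at most
once; there is at least one part) in which each odd part is less than twice the smallest part. -/
def IsNuPartition (n : ℕ) (π : Multiset ℕ) : Prop :=
  π ≠ 0 ∧ π.sum = n ∧ π.Nodup ∧ ∀ i ∈ π, Odd i → i < 2 * smallestPart π

open Classical in
/-- The finite set of all `π` with `IsNuPartition n π`. -/
noncomputable def nuPartitions (n : ℕ) : Finset (Multiset ℕ) :=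
  (Multiset.range (n + 1)).powerset.toFinset.filter (IsNuPartition n)

/-- No partition is lost by the restriction to sub-multisets of `{0, …, n}`. -/
theorem mem_nuPartitions {n : ℕ} {π : Multiset ℕ} :
    π ∈ nuPartitions n ↔ IsNuPartition n π := by
  classical
  simp only [nuPartitions, Finset.mem_filter, Multiset.mem_toFinset, Multiset.mem_powerset,
    and_iff_right_iff_imp]
  rintro ⟨-, hs, hn, -⟩
  refine (Multiset.le_iff_subset hn).2 fun i hi => ?_
  have := Multiset.single_le_sum (fun x _ => Nat.zero_le x) i hi
  exact Multiset.mem_range.2 (by omega)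

/-- `p_ν(n)`: the number of these partitions of `n`. -/
noncomputable def pNu (n : ℕ) : ℕ := (nuPartitions n).card

/-- `spt_ν(n)`: the total number of appearances of the smallest part, over all partitions
counted by `p_ν(n)`. -/
noncomputable def sptNu (n : ℕ) : ℕ := ∑ π ∈ nuPartitions n, π.count (smallestPart π)

/-- `(a; q)_n = ∏_{j=0}^{n-1} (1 - a q^j)`. -/
def qPoch {R : Type*} [CommRing R] (a q : R) (n : ℕ) : R :=
  ∏ j ∈ Finset.range n, (1 - a * q ^ j)

/-- The `n`-th term `q^{n²+n} / (-q; q²)_{n+1}` of the series `ν(q)`, as a formal power series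
in `q = X`; the inverse is a true one, see `qPoch_mul_invOfUnit`. -/
noncomputable def nuTerm (n : ℕ) : PowerSeries ℤ :=
  PowerSeries.X ^ (n ^ 2 + n) *
    PowerSeries.invOfUnit (qPoch (-PowerSeries.X) (PowerSeries.X ^ 2) (n + 1)) 1

theorem qPoch_mul_invOfUnit (n : ℕ) :
    qPoch (-PowerSeries.X : PowerSeries ℤ) (PowerSeries.X ^ 2) n *
      PowerSeries.invOfUnit (qPoch (-PowerSeries.X) (PowerSeries.X ^ 2) n) 1 = 1 := by
  apply PowerSeries.mul_invOfUnit
  simp [qPoch, map_prod]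

open scoped PowerSeries.WithPiTopology in
/-- The third order mock theta function `ν(q) = ∑_{n ≥ 0} q^{n²+n} / (-q; q²)_{n+1}`, as a formal
power series with integer coefficients (the sum is taken coefficientwise). -/
noncomputable def nuSeries : PowerSeries ℤ := ∑' n : ℕ, nuTerm n

open scoped PowerSeries.WithPiTopology in
/-- The defining series converges. -/
theorem summable_nuTerm : Summable nuTerm := by
  apply PowerSeries.WithPiTopology.summable_of_tendsto_order_atTop_nhds_top
  rw [ENat.tendsto_nhds_top_iff_natCast_lt]
  intro m
  filter_upwards [Filter.eventually_gt_atTop m] with n hn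
  refine lt_of_lt_of_le (b := ((n ^ 2 + n : ℕ) : ℕ∞)) (by exact_mod_cast by nlinarith) ?_
  refine le_trans ?_ (PowerSeries.le_order_mul _ _)
  rw [PowerSeries.order_X_pow]
  exact le_self_add

/-! Write (a;b)_n for `qPoch a b n`. Distinctness makes `sptNu` equal to `pNu`, so everything rests
on the generating function of `pNu`. Grouping by number of parts, the partitions with k+1 parts
contribute q^(k²+k)/(q;q²)_{k+1} (`nuPartsSeries_mul_qPoch`), which is the k-th term of ν(-q); hence
ν(-q) generates `pNu`.

Only even exponents matter, and they are isolated by ν(q)+ν(-q). Replacing n²+n by (n-j)(n-j+1) in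
ν(-q) gives series S_j with S_j = (-q;q²)_j (ν(-q) + the first j terms of ν(q)), by
`shiftedNuSeries_eq`. As j grows, only n near j matters in S_j, so (q;q²)_∞ S_j tends to the
two-sided theta series ∑ q^(i(i+1)) = 2ψ(q²), where ψ(q) = ∑_{i≥0} q^(i(i+1)/2). Thus (q²;q⁴)_∞
(ν(q)+ν(-q)) = 2ψ(q²), and with E(q) = ∑ p_ν(2n)qⁿ this reads (q;q²)_∞ E(q) = ψ(q).

With f(q) = (q;q)_∞, Gauss's identity ψ(q) f(q) = f(q²)² turns this into E(q) f(q)² = f(q²)³, so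
E(q) f(q)⁵ = f(q)³ f(q²)³. Modulo 5, f(q)⁵ is f(q⁵) and does not mix residue classes of exponents.
By Jacobi's identity f³ = ∑ (-1)^j (2j+1) q^(j(j+1)/2), an exponent 5n+4 on the right forces x²+2y²
≡ 0 (mod 5) for the odd numbers x, y that are the weights, so 5 divides both. Gauss and Jacobi both
follow from a finite Jacobi triple product. -/

open PowerSeries
open Filter Topology
open scoped PowerSeries.WithPiTopology

/-! ### Subsets counted by cardinality and sum -/

/-- The number of `k`-element subsets of `S` with sum `N`. -/
noncomputable def subsetCount (S : Set ℕ) (k N : ℕ) : ℕ :=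
  Set.ncard {s : Finset ℕ | ↑s ⊆ S ∧ s.card = k ∧ ∑ i ∈ s, i = N}

theorem finite_subsetsWithSum (S : Set ℕ) (k N : ℕ) :
    {s : Finset ℕ | ↑s ⊆ S ∧ s.card = k ∧ ∑ i ∈ s, i = N}.Finite := by
  refine (Finset.finite_toSet (Finset.range (N + 1)).powerset).subset ?_
  rintro s ⟨-, -, hs⟩
  simp only [Finset.coe_powerset, Set.mem_preimage, Set.mem_powerset_iff, Finset.coe_subset]
  intro i hi
  have := Finset.single_le_sum (f := fun i : ℕ => i) (fun _ _ => Nat.zero_le _) hi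
  exact Finset.mem_range.2 (by omega)

/-- The generating function, by sum, of the `k`-element subsets of `S`. -/
noncomputable def subsetSeries (S : Set ℕ) (k : ℕ) : PowerSeries ℤ :=
  PowerSeries.mk fun N => (subsetCount S k N : ℤ)

theorem subsetSeries_zero (S : Set ℕ) : subsetSeries S 0 = 1 := by
  ext N
  rw [subsetSeries, coeff_mk, coeff_one, subsetCount]
  split_ifs with h
  · subst h
    have : {s : Finset ℕ | ↑s ⊆ S ∧ s.card = 0 ∧ ∑ i ∈ s, i = 0} = {∅} := by
      ext s
      simp only [Finset.card_eq_zero, Set.mem_ofPred_eq, Set.mem_singleton_iff]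
      exact ⟨fun h => h.2.1, fun h => by simp [h]⟩
    rw [this]; simp
  · have : {s : Finset ℕ | ↑s ⊆ S ∧ s.card = 0 ∧ ∑ i ∈ s, i = N} = ∅ := by
      ext s
      simp only [Finset.card_eq_zero, Set.mem_ofPred_eq, Set.mem_empty_iff_false, iff_false]
      rintro ⟨-, rfl, h'⟩
      exact h (by simpa using h'.symm)
    rw [this]; simp

/-- Split the subsets according to whether they contain a; erasing a from those that do lowers the
sum by a. -/
theorem subsetSeries_insert {S : Set ℕ} {a : ℕ} (ha : a ∉ S) (k : ℕ) :
    subsetSeries (insert a S) (k + 1) = subsetSeries S (k + 1) + X ^ a * subsetSeries S k := by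
  classical
  ext N
  rw [map_add, coeff_X_pow_mul', subsetSeries, subsetSeries, subsetSeries, coeff_mk, coeff_mk]
  have hsplit : {s : Finset ℕ | ↑s ⊆ insert a S ∧ s.card = k + 1 ∧ ∑ i ∈ s, i = N} =
      {s : Finset ℕ | ↑s ⊆ S ∧ s.card = k + 1 ∧ ∑ i ∈ s, i = N} ∪
      {s : Finset ℕ | a ∈ s ∧ ↑s ⊆ insert a S ∧ s.card = k + 1 ∧ ∑ i ∈ s, i = N} := by
    ext s
    simp only [Set.mem_ofPred_eq, Set.mem_union]
    constructor
    · rintro ⟨h1, h2⟩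
      by_cases h : a ∈ s
      · exact Or.inr ⟨h, h1, h2⟩
      · refine Or.inl ⟨fun i hi => ?_, h2⟩
        rcases h1 hi with rfl | h3
        · exact absurd hi h
        · exact h3
    · rintro (⟨h1, h2⟩ | ⟨-, h⟩)
      · exact ⟨h1.trans (Set.subset_insert _ _), h2⟩
      · exact h
  have hfin : {s : Finset ℕ | a ∈ s ∧ ↑s ⊆ insert a S ∧ s.card = k + 1 ∧
      ∑ i ∈ s, i = N}.Finite :=
    (finite_subsetsWithSum (insert a S) (k + 1) N).subset fun s hs => hs.2
  have hdisj : Disjoint {s : Finset ℕ | ↑s ⊆ S ∧ s.card = k + 1 ∧ ∑ i ∈ s, i = N}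
      {s : Finset ℕ | a ∈ s ∧ ↑s ⊆ insert a S ∧ s.card = k + 1 ∧ ∑ i ∈ s, i = N} := by
    rw [Set.disjoint_left]
    rintro s ⟨h1, -⟩ ⟨h2, -⟩
    exact ha (h1 h2)
  rw [subsetCount, hsplit, Set.ncard_union_eq hdisj (finite_subsetsWithSum _ _ _) hfin,
    Nat.cast_add, subsetCount]
  congr 1
  split_ifs with h
  · rw [coeff_mk, subsetCount]
    congr 1
    symm
    refine Set.ncard_congr (fun s _ => insert a s) ?_ ?_ ?_
    · rintro s ⟨h1, h2, h3⟩
      have has : a ∉ s := fun h => ha (h1 h)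
      refine ⟨Finset.mem_insert_self _ _, ?_, ?_, ?_⟩
      · rw [Finset.coe_insert]; exact Set.insert_subset_insert h1
      · rw [Finset.card_insert_of_notMem has, h2]
      · rw [Finset.sum_insert has, h3]; omega
    · rintro s t ⟨h1, -⟩ ⟨h1', -⟩ hst
      have has : a ∉ s := fun h => ha (h1 h)
      have hat : a ∉ t := fun h => ha (h1' h)
      rw [← Finset.erase_insert has, hst, Finset.erase_insert hat]
    · rintro s ⟨h0, h1, h2, h3⟩
      refine ⟨s.erase a, ⟨fun i hi => ?_, ?_, ?_⟩, Finset.insert_erase h0⟩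
      · have hi' := Finset.mem_erase.1 (Finset.mem_coe.1 hi)
        exact (h1 hi'.2).resolve_left hi'.1
      · rw [Finset.card_erase_of_mem h0, h2]; rfl
      · have := Finset.add_sum_erase s (fun i => i) h0
        omega
  · rw [Nat.cast_eq_zero, Set.ncard_eq_zero hfin, Set.eq_empty_iff_forall_notMem]
    rintro s ⟨h1, -, -, h3⟩
    have := Finset.single_le_sum (f := fun i : ℕ => i) (fun _ _ => Nat.zero_le _) h1
    omega

theorem subsetSeries_image_add (S : Set ℕ) (d k : ℕ) :
    subsetSeries ((· + d) '' S) k = X ^ (d * k) * subsetSeries S k := by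
  classical
  ext N
  have hsum (s : Finset ℕ) : ∑ i ∈ s.map (addRightEmbedding d), i = ∑ i ∈ s, i + d * s.card := by
    simp [Finset.sum_map, Finset.sum_add_distrib, mul_comm]
  have hpre (s : Finset ℕ) (hs : (s : Set ℕ) ⊆ (· + d) '' S) :
      ∃ t : Finset ℕ, ↑t ⊆ S ∧ t.map (addRightEmbedding d) = s := by
    obtain ⟨t, ht, rfl⟩ := Finset.subset_set_image_iff.1 hs
    refine ⟨t, ht, ?_⟩
    rw [Finset.map_eq_image]; rfl
  rw [coeff_X_pow_mul', subsetSeries, subsetSeries, coeff_mk]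
  split_ifs with h
  · rw [coeff_mk, subsetCount, subsetCount]
    congr 1
    symm
    refine Set.ncard_congr (fun s _ => s.map (addRightEmbedding d)) ?_ ?_ ?_
    · rintro s ⟨h1, h2, h3⟩
      refine ⟨?_, ?_, ?_⟩
      · rw [Finset.coe_map]
        exact Set.image_mono h1
      · rw [Finset.card_map, h2]
      · rw [hsum, h2, h3]; omega
    · intro s t _ _ hst
      exact Finset.map_injective _ hst
    · rintro s ⟨h1, h2, h3⟩
      obtain ⟨t, ht, rfl⟩ := hpre s h1
      rw [Finset.card_map] at h2
      rw [hsum, h2] at h3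
      exact ⟨t, ⟨ht, h2, by omega⟩, rfl⟩
  · rw [Nat.cast_eq_zero, subsetCount, Set.ncard_eq_zero (finite_subsetsWithSum _ _ _),
      Set.eq_empty_iff_forall_notMem]
    rintro s ⟨h1, h2, h3⟩
    obtain ⟨t, ht, rfl⟩ := hpre s h1
    rw [Finset.card_map] at h2
    rw [hsum, h2] at h3
    omega

/-! ### Companions of a given smallest part -/

/-- The parts which may accompany the smallest part `m`. -/
def nuTail (m : ℕ) : Set ℕ := {i | m < i ∧ (Odd i → i < 2 * m)}

theorem nuTail_one : nuTail 1 = nuTail 0 := by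
  ext i
  simp only [nuTail, Set.mem_ofPred_eq]
  grind

/-- Translation by 2 turns the bound on odd parts from 2m into 2(m+1), exactly as needed, but moves
the lower bound one step too far, losing only m+2. -/
theorem nuTail_succ (m : ℕ) : nuTail (m + 1) = insert (m + 2) ((· + 2) '' nuTail m) := by
  ext i
  simp only [nuTail, Set.mem_ofPred_eq, Set.mem_insert_iff, Set.mem_image]
  constructor
  · rintro ⟨h1, h2⟩
    refine or_iff_not_imp_left.2 fun h => ⟨i - 2, ⟨by omega, fun h3 => ?_⟩, by omega⟩
    have := h2 (by rw [Nat.odd_iff] at *; omega)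
    omega
  · rintro (rfl | ⟨j, ⟨h1, h2⟩, rfl⟩)
    · exact ⟨by omega, fun h => by rw [Nat.odd_iff] at h; omega⟩
    · refine ⟨by omega, fun h => ?_⟩
      have := h2 (by rw [Nat.odd_iff] at *; omega)
      omega

/-- Here translation by 2 gives the right lower bound, but the odd bound is 2m+2 instead of 2m+4,
losing only the odd number 2m+3. -/
theorem nuTail_add_two (m : ℕ) :
    nuTail (m + 2) = insert (2 * m + 3) ((· + 2) '' nuTail m) := by
  ext i
  simp only [nuTail, Set.mem_ofPred_eq, Set.mem_insert_iff, Set.mem_image]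
  constructor
  · rintro ⟨h1, h2⟩
    refine or_iff_not_imp_left.2 fun h => ⟨i - 2, ⟨by omega, fun h3 => ?_⟩, by omega⟩
    have h4 : Odd i := by rw [Nat.odd_iff] at *; omega
    have := h2 h4
    rw [Nat.odd_iff] at h4
    omega
  · rintro (rfl | ⟨j, ⟨h1, h2⟩, rfl⟩)
    · exact ⟨by omega, fun h => by omega⟩
    · refine ⟨by omega, fun h => ?_⟩
      have := h2 (by rw [Nat.odd_iff] at *; omega)
      omega

/-- The generating function of the `k`-element sets of parts that may accompany `m`. -/
noncomputable abbrev nuTailSeries (m k : ℕ) : PowerSeries ℤ := subsetSeries (nuTail m) k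

theorem nuTailSeries_succ (m k : ℕ) : nuTailSeries (m + 1) (k + 1) =
    X ^ (2 * k + 2) * nuTailSeries m (k + 1) + X ^ (m + 2 + 2 * k) * nuTailSeries m k := by
  rw [nuTailSeries, nuTail_succ, subsetSeries_insert, subsetSeries_image_add,
    subsetSeries_image_add, ← mul_assoc, ← pow_add, mul_add, mul_one]
  rintro ⟨i, ⟨h, -⟩, h'⟩
  simp only at h'
  omega

theorem nuTailSeries_add_two (m k : ℕ) : nuTailSeries (m + 2) (k + 1) =
    X ^ (2 * k + 2) * nuTailSeries m (k + 1) + X ^ (2 * m + 3 + 2 * k) * nuTailSeries m k := by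
  rw [nuTailSeries, nuTail_add_two, subsetSeries_insert, subsetSeries_image_add,
    subsetSeries_image_add, ← mul_assoc, ← pow_add, mul_add, mul_one]
  rintro ⟨i, ⟨h, h2⟩, h'⟩
  simp only at h'
  have := h2 (by rw [Nat.odd_iff]; omega)
  omega

/-! ### Partitions sorted by smallest part and number of parts -/

theorem smallestPart_mem {π : Multiset ℕ} (h : π ≠ 0) : smallestPart π ∈ π :=
  Nat.sInf_mem (s := {i | i ∈ π}) (Multiset.exists_mem_of_ne_zero h)

theorem smallestPart_le {π : Multiset ℕ} {i : ℕ} (h : i ∈ π) : smallestPart π ≤ i :=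
  Nat.sInf_le (s := {i | i ∈ π}) h

theorem smallestPart_cons {m : ℕ} {π : Multiset ℕ} (h : ∀ i ∈ π, m ≤ i) :
    smallestPart (m ::ₘ π) = m := by
  refine le_antisymm (smallestPart_le (Multiset.mem_cons_self _ _)) ?_
  rcases Multiset.mem_cons.1 (smallestPart_mem (Multiset.cons_ne_zero (a := m) (m := π))) with h1 | h1
  · exact h1.ge
  · exact h _ h1

theorem sptNu_eq_pNu (n : ℕ) : sptNu n = pNu n := by
  rw [sptNu, pNu, Finset.card_eq_sum_ones]
  refine Finset.sum_congr rfl fun π hπ => ?_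
  obtain ⟨h0, -, hd, -⟩ := mem_nuPartitions.1 hπ
  exact Multiset.count_eq_one_of_mem hd (smallestPart_mem h0)

theorem card_nuPartitions_smallestPart {m N : ℕ} (h : m ≤ N) (k : ℕ) :
    ((nuPartitions N).filter fun π => π.card = k + 1 ∧ smallestPart π = m).card =
      subsetCount (nuTail m) k (N - m) := by
  rw [← Set.ncard_coe_finset, subsetCount]
  symm
  refine Set.ncard_congr (fun s _ => m ::ₘ s.val) ?_ ?_ ?_
  · rintro s ⟨h1, h2, h3⟩
    have hs : smallestPart (m ::ₘ s.val) = m :=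
      smallestPart_cons fun i hi => (h1 (Finset.mem_def.2 hi)).1.le
    have hsum : s.val.sum = N - m := by rw [← h3, Finset.sum, Multiset.map_id']
    simp only [Finset.coe_filter, Set.mem_ofPred_eq, mem_nuPartitions]
    refine ⟨⟨Multiset.cons_ne_zero, ?_, ?_, ?_⟩, ?_, hs⟩
    · rw [Multiset.sum_cons, hsum]; omega
    · exact Multiset.nodup_cons.2 ⟨fun hm => lt_irrefl _ (h1 (Finset.mem_def.2 hm)).1, s.nodup⟩
    · rw [hs]
      intro i hi hodd
      rcases Multiset.mem_cons.1 hi with rfl | hi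
      -- The smallest part obeys its own bound: if odd it is positive, so m < 2m.
      · have := hodd.pos; omega
      · exact (h1 (Finset.mem_def.2 hi)).2 hodd
    · rw [Multiset.card_cons, Finset.card_val, h2]
  · intro s t _ _ hst
    exact Finset.val_injective ((Multiset.cons_inj_right m).1 hst)
  · intro π hπ
    simp only [Finset.coe_filter, Set.mem_ofPred_eq, mem_nuPartitions] at hπ
    obtain ⟨⟨h0, h1, h2, h3⟩, h4, h5⟩ := hπ
    have hm : m ∈ π := h5 ▸ smallestPart_mem h0
    obtain ⟨ρ, rfl⟩ := Multiset.exists_cons_of_mem hm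
    rw [Multiset.nodup_cons] at h2
    refine ⟨⟨ρ, h2.2⟩, ⟨fun i hi => ?_, ?_, ?_⟩, rfl⟩
    · have hi' : i ∈ ρ := hi
      have hle := smallestPart_le (Multiset.mem_cons_of_mem (b := m) hi')
      rw [h5] at hle
      refine ⟨lt_of_le_of_ne hle fun h => h2.1 (h ▸ hi'), fun ho => ?_⟩
      have := h3 i (Multiset.mem_cons_of_mem hi') ho
      rwa [h5] at this
    · rw [Multiset.card_cons] at h4
      exact Nat.succ_injective h4
    · rw [Multiset.sum_cons] at h1
      rw [Finset.sum, Multiset.map_id']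
      simp only
      omega

/-- The generating function of the partitions counted by `pNu` that have `k + 1` parts. -/
noncomputable def nuPartsSeries (k : ℕ) : PowerSeries ℤ :=
  PowerSeries.mk fun N => (((nuPartitions N).filter fun π => π.card = k + 1).card : ℤ)

theorem card_nuPartitions_filter (k N : ℕ) :
    ((nuPartitions N).filter fun π => π.card = k + 1).card =
      ∑ m ∈ Finset.range (N + 1), subsetCount (nuTail m) k (N - m) := by
  rw [Finset.card_eq_sum_card_fiberwise (f := smallestPart) (t := Finset.range (N + 1))]
  · refine Finset.sum_congr rfl fun m hm => ?_
    rw [← card_nuPartitions_smallestPart (by simpa [Nat.lt_succ_iff] using hm), Finset.filter_filter]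
  · intro π hπ
    simp only [Finset.coe_filter, Set.mem_ofPred_eq, mem_nuPartitions] at hπ
    have := Multiset.single_le_sum (fun x _ => Nat.zero_le x) _ (smallestPart_mem hπ.1.1)
    rw [hπ.1.2.1] at this
    simpa [Nat.lt_succ_iff] using this

theorem pNu_eq_sum (N : ℕ) :
    (pNu N : ℤ) = ∑ k ∈ Finset.range (N + 1), coeff N (nuPartsSeries k) := by
  simp only [nuPartsSeries, coeff_mk]
  rw [pNu, ← Nat.cast_sum, Finset.card_eq_sum_card_fiberwise (f := fun π => π.card - 1)
    (t := Finset.range (N + 1))]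
  · congr 1
    refine Finset.sum_congr rfl fun k hk => ?_
    congr 1
    refine Finset.filter_congr fun π hπ => ?_
    have := Multiset.card_pos.2 (mem_nuPartitions.1 hπ).1
    omega
  · intro π hπ
    have hπ' : IsNuPartition N π := mem_nuPartitions.1 hπ
    -- There are at most N+1 distinct parts in {0, …, N}, so the index k = card - 1 is at most N.
    have hle : π ≤ Multiset.range (N + 1) := by
      refine (Multiset.le_iff_subset hπ'.2.2.1).2 fun i hi => ?_
      have := Multiset.single_le_sum (fun x _ => Nat.zero_le x) i hi
      rw [hπ'.2.1] at this
      exact Multiset.mem_range.2 (by omega)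
    have := Multiset.card_le_card hle
    rw [Multiset.card_range] at this
    simp only [Finset.coe_range, Set.mem_Iio]
    omega

/-! ### Coefficientwise limits -/

theorem tendsto_atTop_of_X_pow_dvd_sub {a b : ℕ → ℤ⟦X⟧} {l : ℤ⟦X⟧} {e : ℕ → ℕ}
    (hb : Tendsto b atTop (𝓝 l)) (he : Tendsto e atTop atTop)
    (h : ∀ n, X ^ e n ∣ a n - b n) : Tendsto a atTop (𝓝 l) := by
  rw [WithPiTopology.tendsto_iff_coeff_tendsto] at hb ⊢
  intro d
  refine (hb d).congr' ?_
  filter_upwards [he.eventually_gt_atTop d] with n hn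
  have := X_pow_dvd_iff.1 (h n) d hn
  rw [map_sub, sub_eq_zero] at this
  exact this.symm

theorem tendsto_atTop_zero_of_X_pow_dvd {a : ℕ → ℤ⟦X⟧} {e : ℕ → ℕ}
    (he : Tendsto e atTop atTop) (h : ∀ n, X ^ e n ∣ a n) : Tendsto a atTop (𝓝 0) :=
  tendsto_atTop_of_X_pow_dvd_sub tendsto_const_nhds he (by simpa using h)

theorem summable_of_X_pow_dvd {a : ℕ → ℤ⟦X⟧} (h : ∀ n, X ^ n ∣ a n) : Summable a := by
  apply WithPiTopology.summable_of_tendsto_order_atTop_nhds_top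
  rw [ENat.tendsto_nhds_top_iff_natCast_lt]
  intro m
  filter_upwards [eventually_gt_atTop m] with n hn
  exact lt_of_lt_of_le (Nat.cast_lt.2 hn) (nat_le_order _ _ (X_pow_dvd_iff.1 (h n)))

theorem coeff_tsum_of_X_pow_dvd {a : ℕ → ℤ⟦X⟧} (h : ∀ n, X ^ n ∣ a n) (N : ℕ) :
    coeff N (∑' n, a n) = ∑ n ∈ Finset.range (N + 1), coeff N (a n) := by
  have h1 := (summable_of_X_pow_dvd h).hasSum
  rw [WithPiTopology.hasSum_iff_hasSum_coeff] at h1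
  refine (h1 N).unique (hasSum_sum_of_ne_finset_zero fun n hn => ?_)
  rw [Finset.mem_range, not_lt] at hn
  exact X_pow_dvd_iff.1 (h n) N (by omega)

/-! ### Closed form by number of parts, and ν(-q) -/

theorem hasSum_nuPartsSeries (k : ℕ) :
    HasSum (fun m => X ^ m * nuTailSeries m k) (nuPartsSeries k) := by
  have hd : ∀ m, (X : ℤ⟦X⟧) ^ m ∣ X ^ m * nuTailSeries m k := fun m => dvd_mul_right _ _
  have heq : nuPartsSeries k = ∑' m, X ^ m * nuTailSeries m k := by
    ext N
    rw [coeff_tsum_of_X_pow_dvd hd, nuPartsSeries, coeff_mk, card_nuPartitions_filter, Nat.cast_sum]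
    refine Finset.sum_congr rfl fun m hm => ?_
    rw [coeff_X_pow_mul', if_pos (by simpa [Nat.lt_succ_iff] using hm), nuTailSeries, subsetSeries, coeff_mk]
  rw [heq]
  exact (summable_of_X_pow_dvd hd).hasSum

theorem nuPartsSeries_zero : nuPartsSeries 0 * (1 - X) = 1 := by
  have h := hasSum_nuPartsSeries 0
  simp only [subsetSeries_zero, mul_one] at h
  have h1 := (hasSum_nat_add_iff' 1).2 h
  have h2 := h.mul_left X
  simp only [← pow_succ'] at h2
  have h3 := h1.unique h2
  simp only [Finset.range_one, Finset.sum_singleton, pow_zero] at h3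
  linear_combination h3

theorem X_pow_dvd_nuTailSeries_succ (m k : ℕ) : X ^ m ∣ nuTailSeries m (k + 1) := by
  induction m using Nat.strong_induction_on with
  | _ m ih =>
    match m with
    | 0 => simp
    | m + 1 =>
      rw [nuTailSeries_succ]
      refine dvd_add ?_ ?_
      · rw [pow_succ']
        exact mul_dvd_mul (dvd_pow_self _ (by omega)) (ih m (by omega))
      · exact (pow_dvd_pow _ (by omega)).mul_right _

/-- Summing `nuTailSeries_succ` against q^(m+1) gives one relation, containing the unwanted series Q
and the m = 0 term. The difference of the two tail recurrences telescopes over m and gives a second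
one with the same Q and, through `nuTail_one`, the same m = 0 term. Combining them eliminates both.
-/
theorem nuPartsSeries_succ (k : ℕ) :
    nuPartsSeries (k + 1) * (1 - X ^ (2 * k + 3)) = X ^ (2 * k + 2) * nuPartsSeries k := by
  have hP := hasSum_nuPartsSeries k
  have hP' := hasSum_nuPartsSeries (k + 1)
  obtain ⟨Q, hQ⟩ : Summable fun m => (X : ℤ⟦X⟧) ^ (2 * m) * nuTailSeries m k :=
    summable_of_X_pow_dvd fun m => (pow_dvd_pow _ (by omega)).mul_right _
  have h1 := (hasSum_nat_add_iff' 1).2 hP'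
  have h2 : HasSum (fun m => X ^ (m + 1) * nuTailSeries (m + 1) (k + 1))
      (X ^ (2 * k + 3) * nuPartsSeries (k + 1) + X ^ (2 * k + 3) * Q) := by
    refine ((hP'.mul_left (X ^ (2 * k + 3))).add (hQ.mul_left (X ^ (2 * k + 3)))).congr_fun ?_
    intro m
    rw [nuTailSeries_succ]
    ring
  have h3 : HasSum (fun m => nuTailSeries (m + 1) (k + 1) - nuTailSeries (m + 2) (k + 1))
      (X ^ (2 * k + 2) * nuPartsSeries k - X ^ (2 * k + 3) * Q) := by
    refine ((hP.mul_left (X ^ (2 * k + 2))).sub (hQ.mul_left (X ^ (2 * k + 3)))).congr_fun ?_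
    intro m
    rw [nuTailSeries_succ, nuTailSeries_add_two]
    ring
  have h4 : Tendsto (fun n => nuTailSeries 1 (k + 1) - nuTailSeries (n + 1) (k + 1)) atTop
      (𝓝 (nuTailSeries 1 (k + 1) - 0)) :=
    tendsto_const_nhds.sub (tendsto_atTop_zero_of_X_pow_dvd (tendsto_add_atTop_nat 1)
      fun n => X_pow_dvd_nuTailSeries_succ (n + 1) k)
  have h5 := h3.tendsto_sum_nat
  have h6 := tendsto_nhds_unique (h5.congr fun n =>
    Finset.sum_range_sub' (fun m => nuTailSeries (m + 1) (k + 1)) n) h4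
  have h7 := h1.unique h2
  simp only [Finset.range_one, Finset.sum_singleton, pow_zero, one_mul] at h7
  rw [nuTailSeries, nuTail_one] at h6
  linear_combination h7 - h6

theorem nuPartsSeries_mul_qPoch (k : ℕ) :
    nuPartsSeries k * qPoch X (X ^ 2) (k + 1) = X ^ (k ^ 2 + k) := by
  induction k with
  | zero => simpa [qPoch] using nuPartsSeries_zero
  | succ k ih =>
    rw [qPoch, Finset.prod_range_succ, ← qPoch]
    have h := nuPartsSeries_succ k
    calc _ = (nuPartsSeries (k + 1) * (1 - X ^ (2 * k + 3))) * qPoch X (X ^ 2) (k + 1) := by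
          rw [← pow_mul]; ring
      _ = X ^ (2 * k + 2) * (nuPartsSeries k * qPoch X (X ^ 2) (k + 1)) := by rw [h]; ring
      _ = _ := by rw [ih]; ring

theorem constantCoeff_qPoch_X (n : ℕ) :
    constantCoeff (qPoch (X : ℤ⟦X⟧) (X ^ 2) n) = 1 := by
  simp [qPoch, map_prod]

theorem qPoch_X_ne_zero (n : ℕ) : qPoch (X : ℤ⟦X⟧) (X ^ 2) n ≠ 0 := fun h => by
  simpa [h] using constantCoeff_qPoch_X n

theorem rescale_neg_one_qPoch (n : ℕ) :
    rescale (-1 : ℤ) (qPoch (-X) (X ^ 2) n) = qPoch X (X ^ 2) n := by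
  simp [qPoch, map_prod, rescale_X, sub_eq_add_neg]

/-- Under q ↦ -q the numerator is unchanged because n²+n is even, and (-q;q²)_{n+1} becomes
(q;q²)_{n+1}. -/
theorem rescale_neg_one_nuTerm (n : ℕ) : rescale (-1 : ℤ) (nuTerm n) = nuPartsSeries n := by
  apply mul_right_cancel₀ (qPoch_X_ne_zero (n + 1))
  rw [nuPartsSeries_mul_qPoch, nuTerm, map_mul, ← rescale_neg_one_qPoch, mul_assoc, ← map_mul,
    mul_comm (invOfUnit _ _), qPoch_mul_invOfUnit, map_one, mul_one, map_pow, rescale_X, mul_pow,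
    ← map_pow, Even.neg_one_pow, map_one, one_mul]
  rw [sq]
  exact Nat.even_mul_succ_self n

theorem X_pow_dvd_nuPartsSeries (n : ℕ) : X ^ n ∣ nuPartsSeries n := by
  have h : IsUnit (qPoch (X : ℤ⟦X⟧) (X ^ 2) (n + 1)) := by
    rw [isUnit_iff_constantCoeff, constantCoeff_qPoch_X]; exact isUnit_one
  rw [← h.dvd_mul_right, nuPartsSeries_mul_qPoch]
  exact pow_dvd_pow _ (by omega)

theorem X_pow_dvd_nuTerm (n : ℕ) : X ^ n ∣ nuTerm n :=
  (pow_dvd_pow _ (by omega)).mul_right _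

theorem coeff_rescale_nuSeries (N : ℕ) :
    coeff N (rescale (-1 : ℤ) nuSeries) = pNu N := by
  rw [coeff_rescale, nuSeries, coeff_tsum_of_X_pow_dvd X_pow_dvd_nuTerm, Finset.mul_sum, pNu_eq_sum]
  refine Finset.sum_congr rfl fun k _ => ?_
  rw [← coeff_rescale, rescale_neg_one_nuTerm]

theorem hasSum_nuTerm : HasSum nuTerm nuSeries := summable_nuTerm.hasSum

theorem hasSum_nuPartsSeries_rescale : HasSum nuPartsSeries (rescale (-1 : ℤ) nuSeries) := by
  have : rescale (-1 : ℤ) nuSeries = ∑' n, nuPartsSeries n := by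
    ext N
    rw [coeff_tsum_of_X_pow_dvd X_pow_dvd_nuPartsSeries, coeff_rescale_nuSeries, pNu_eq_sum]
  rw [this]
  exact (summable_of_X_pow_dvd X_pow_dvd_nuPartsSeries).hasSum

/-! ### Infinite products and their truncation errors -/

theorem X_pow_dvd_of_tendsto {a : ℕ → ℤ⟦X⟧} {l : ℤ⟦X⟧} {N : ℕ} (h : Tendsto a atTop (𝓝 l))
    (ha : ∀ᶠ n in atTop, X ^ N ∣ a n) : X ^ N ∣ l := by
  rw [WithPiTopology.tendsto_iff_coeff_tendsto] at h
  refine X_pow_dvd_iff.2 fun d hd => tendsto_nhds_unique (h d) ?_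
  refine tendsto_const_nhds.congr' ?_
  filter_upwards [ha] with n hn
  exact (X_pow_dvd_iff.1 hn d hd).symm

theorem X_pow_dvd_of_hasSum {a : ℕ → ℤ⟦X⟧} {l : ℤ⟦X⟧} {N : ℕ} (h : HasSum a l)
    (ha : ∀ n, X ^ N ∣ a n) : X ^ N ∣ l :=
  X_pow_dvd_of_tendsto h.tendsto_sum_nat (Eventually.of_forall fun _ =>
    Finset.dvd_sum fun i _ => ha i)

theorem tendsto_prod_one_add {f : ℕ → ℤ⟦X⟧} (h : ∀ n, X ^ n ∣ f n) :
    Tendsto (fun n => ∏ i ∈ Finset.range n, (1 + f i)) atTop (𝓝 (∏' n, (1 + f n))) := by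
  have hm : Multipliable fun n => 1 + f n := by
    apply WithPiTopology.multipliable_one_add_of_tendsto_order_atTop_nhds_top
    rw [ENat.tendsto_nhds_top_iff_natCast_lt]
    intro m
    filter_upwards [eventually_gt_atTop m] with n hn
    exact lt_of_lt_of_le (Nat.cast_lt.2 hn) (nat_le_order _ _ (X_pow_dvd_iff.1 (h n)))
  exact hm.hasProd.tendsto_prod_nat

theorem X_pow_dvd_prod_sub_prod {f : ℕ → ℤ⟦X⟧} {n m N : ℕ} (hnm : n ≤ m)
    (h : ∀ i, n ≤ i → X ^ N ∣ f i) :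
    X ^ N ∣ ∏ i ∈ Finset.range m, (1 + f i) - ∏ i ∈ Finset.range n, (1 + f i) := by
  induction m, hnm using Nat.le_induction with
  | base => simp
  | succ m hm ih =>
    rw [Finset.prod_range_succ, mul_add, mul_one, add_sub_right_comm]
    exact dvd_add ih ((h m hm).mul_left _)

theorem X_pow_dvd_tprod_sub_prod {f : ℕ → ℤ⟦X⟧} (hf : ∀ n, X ^ n ∣ f n) {n N : ℕ}
    (h : ∀ i, n ≤ i → X ^ N ∣ f i) :
    X ^ N ∣ ∏' n, (1 + f n) - ∏ i ∈ Finset.range n, (1 + f i) := by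
  refine X_pow_dvd_of_tendsto ((tendsto_prod_one_add hf).sub tendsto_const_nhds) ?_
  filter_upwards [eventually_ge_atTop n] with m hm
  exact X_pow_dvd_prod_sub_prod hm h

theorem continuous_expand {p : ℕ} (hp : p ≠ 0) :
    Continuous (fun f : ℤ⟦X⟧ => expand p hp f) := by
  refine continuous_iff_continuousAt.2 fun f => ?_
  rw [ContinuousAt, WithPiTopology.tendsto_iff_coeff_tendsto]
  intro d
  simp only [coeff_expand]
  split_ifs
  · exact (WithPiTopology.continuous_coeff ℤ _).continuousAt
  · exact tendsto_const_nhds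

/-- The infinite product `(q; q)_∞`. -/
noncomputable def eulerSeries : ℤ⟦X⟧ := ∏' n : ℕ, (1 + -(X * X ^ n))

/-- The infinite product `(q; q²)_∞`. -/
noncomputable def oddEulerSeries : ℤ⟦X⟧ := ∏' n : ℕ, (1 + -(X * (X ^ 2) ^ n))

theorem tendsto_qPoch_X_X : Tendsto (qPoch (X : ℤ⟦X⟧) X) atTop (𝓝 eulerSeries) := by
  refine (tendsto_prod_one_add (f := fun n => -((X : ℤ⟦X⟧) * X ^ n)) fun n => ?_).congr fun n => ?_
  · exact (dvd_mul_left _ _).neg_right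
  · simp [qPoch, sub_eq_add_neg]

theorem X_pow_dvd_X_mul_sq_pow (n : ℕ) : (X : ℤ⟦X⟧) ^ n ∣ X * (X ^ 2) ^ n := by
  rw [← pow_mul, ← pow_succ']
  exact pow_dvd_pow _ (by omega)

theorem tendsto_qPoch_X_sq :
    Tendsto (qPoch (X : ℤ⟦X⟧) (X ^ 2)) atTop (𝓝 oddEulerSeries) := by
  refine (tendsto_prod_one_add (f := fun n => -((X : ℤ⟦X⟧) * (X ^ 2) ^ n)) fun n => ?_).congr
    fun n => ?_
  · exact (X_pow_dvd_X_mul_sq_pow n).neg_right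
  · simp [qPoch, sub_eq_add_neg]

theorem X_pow_dvd_oddEulerSeries_sub (n : ℕ) :
    X ^ (2 * n + 1) ∣ oddEulerSeries - qPoch X (X ^ 2) n := by
  simp only [qPoch, sub_eq_add_neg (1 : ℤ⟦X⟧)]
  refine X_pow_dvd_tprod_sub_prod (fun n => (X_pow_dvd_X_mul_sq_pow n).neg_right) fun i hi => ?_
  rw [← pow_mul, ← pow_succ']
  exact (pow_dvd_pow _ (by omega)).neg_right

theorem X_pow_dvd_eulerSeries_sub (n : ℕ) : X ^ (n + 1) ∣ eulerSeries - qPoch X X n := by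
  simp only [qPoch, sub_eq_add_neg (1 : ℤ⟦X⟧)]
  refine X_pow_dvd_tprod_sub_prod (fun n => (dvd_mul_left _ _).neg_right) fun i hi => ?_
  rw [← pow_succ']
  exact (pow_dvd_pow _ (by omega)).neg_right

/-- Separate the first 2n factors of (q;q)_∞ into odd and even exponents, and let n grow. -/
theorem oddEulerSeries_mul_expand_eulerSeries :
    oddEulerSeries * expand 2 two_ne_zero eulerSeries = eulerSeries := by
  have h1 := tendsto_qPoch_X_sq.mul
    (((continuous_expand two_ne_zero).tendsto _).comp tendsto_qPoch_X_X)
  have h2 : Tendsto (fun n => qPoch (X : ℤ⟦X⟧) X (2 * n)) atTop (𝓝 eulerSeries) :=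
    tendsto_qPoch_X_X.comp (tendsto_id.const_mul_atTop' two_pos)
  refine tendsto_nhds_unique (h1.congr fun n => ?_) h2
  induction n with
  | zero => simp [qPoch]
  | succ n ih =>
    simp only [qPoch, Function.comp_apply, map_prod] at ih ⊢
    rw [show 2 * (n + 1) = 2 * n + 1 + 1 by ring, Finset.prod_range_succ, Finset.prod_range_succ,
      Finset.prod_range_succ, Finset.prod_range_succ, ← ih]
    simp only [map_sub, map_mul, map_pow, map_one, expand_X]
    ring

/-! ### Series over triangular numbers -/

/-- The partial theta series `∑ c_j q^{j(j+1)/2}`. -/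
noncomputable def triangularSeries (c : ℕ → ℤ) : ℤ⟦X⟧ := ∑' j, C (c j) * X ^ (j * (j + 1) / 2)

theorem le_triangular (j : ℕ) : j ≤ j * (j + 1) / 2 := by
  rw [Nat.le_div_iff_mul_le two_pos]
  rcases j with _ | j
  · simp
  · exact Nat.mul_le_mul_left _ (by omega)

theorem X_pow_dvd_triangular (c : ℕ → ℤ) (j : ℕ) :
    (X : ℤ⟦X⟧) ^ j ∣ C (c j) * X ^ (j * (j + 1) / 2) :=
  (pow_dvd_pow _ (le_triangular j)).mul_left _

theorem hasSum_triangularSeries (c : ℕ → ℤ) :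
    HasSum (fun j => C (c j) * X ^ (j * (j + 1) / 2)) (triangularSeries c) :=
  (summable_of_X_pow_dvd (X_pow_dvd_triangular c)).hasSum

theorem coeff_triangularSeries (c : ℕ → ℤ) (N : ℕ) : coeff N (triangularSeries c) =
    ∑ j ∈ Finset.range (N + 1), if N = j * (j + 1) / 2 then c j else 0 := by
  rw [triangularSeries, coeff_tsum_of_X_pow_dvd (X_pow_dvd_triangular c)]
  simp only [coeff_C_mul, coeff_X_pow, mul_ite, mul_one, mul_zero]

theorem hasSum_expand_triangularSeries_one :
    HasSum (fun j : ℕ => (X : ℤ⟦X⟧) ^ (j * (j + 1)))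
      (expand 2 two_ne_zero (triangularSeries fun _ => 1)) := by
  have := (hasSum_triangularSeries fun _ => 1).map (expand 2 two_ne_zero)
    (continuous_expand two_ne_zero)
  refine this.congr_fun fun j => ?_
  simp only [Function.comp_apply, map_pow, expand_X, map_one, one_mul]
  rw [← pow_mul, Nat.mul_div_cancel' (Nat.even_mul_succ_self j).two_dvd]

/-! ### The even part of ν via shifted series -/

/-- The inverse of `(q; q²)_n`. -/
noncomputable def qPochInv (n : ℕ) : ℤ⟦X⟧ := invOfUnit (qPoch X (X ^ 2) n) 1

theorem qPoch_mul_qPochInv (n : ℕ) : qPoch X (X ^ 2) n * qPochInv n = 1 := by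
  apply mul_invOfUnit
  rw [constantCoeff_qPoch_X]; rfl

theorem qPochInv_succ (n : ℕ) : qPochInv (n + 1) * (1 - X ^ (2 * n + 1)) = qPochInv n := by
  apply mul_left_cancel₀ (qPoch_X_ne_zero n)
  have h : qPoch (X : ℤ⟦X⟧) (X ^ 2) (n + 1) = qPoch X (X ^ 2) n * (1 - X ^ (2 * n + 1)) := by
    rw [qPoch, Finset.prod_range_succ, ← qPoch, ← pow_mul, ← pow_succ']
  have h1 := qPoch_mul_qPochInv (n + 1)
  rw [h] at h1
  linear_combination h1 - qPoch_mul_qPochInv n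

theorem nuPartsSeries_eq (n : ℕ) : nuPartsSeries n = X ^ (n ^ 2 + n) * qPochInv (n + 1) := by
  rw [← nuPartsSeries_mul_qPoch, mul_assoc, qPoch_mul_qPochInv, mul_one]

/-- The product `(n - j)(n - j + 1)` of consecutive integers. -/
def shiftedPronic (j n : ℕ) : ℕ := (((n : ℤ) - j) * (n - j + 1)).toNat

theorem coe_shiftedPronic (j n : ℕ) :
    (shiftedPronic j n : ℤ) = ((n : ℤ) - j) * (n - j + 1) := by
  refine Int.toNat_of_nonneg ?_
  rcases le_or_gt (j : ℤ) n with h | h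
  · exact mul_nonneg (by omega) (by omega)
  · exact mul_nonneg_of_nonpos_of_nonpos (by omega) (by omega)

theorem sub_le_shiftedPronic (j n : ℕ) : n - j ≤ shiftedPronic j n := by
  zify [coe_shiftedPronic]
  rcases le_or_gt j n with h | h
  · push_cast [h]
    have : (0 : ℤ) ≤ n - j := by omega
    nlinarith
  · rw [Nat.sub_eq_zero_of_le h.le, ← coe_shiftedPronic]
    positivity

theorem shiftedPronic_add (j n : ℕ) :
    shiftedPronic j n + (2 * j + 1) = shiftedPronic (j + 1) n + (2 * n + 1) := by
  zify [coe_shiftedPronic]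
  ring

theorem shiftedPronic_succ_succ (j n : ℕ) :
    shiftedPronic (j + 1) (n + 1) = shiftedPronic j n := by
  zify [coe_shiftedPronic]
  ring

/-- The difference of the two sides is (n-j+1)(n-j+2), a product of consecutive integers. This makes
the truncation error in `expand_oddEulerSeries_mul_nuSeries` uniform in n. -/
theorem le_shiftedPronic_add (j n : ℕ) : 2 * j + 1 ≤ shiftedPronic j n + (2 * (n + 1) + 1) := by
  have h := coe_shiftedPronic j n
  have h1 : 0 ≤ ((n : ℤ) - j + 1) * (n - j + 2) := by
    rcases le_or_gt (j : ℤ) (n + 1) with h | h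
    · exact mul_nonneg (by omega) (by omega)
    · exact mul_nonneg_of_nonpos_of_nonpos (by omega) (by omega)
  zify
  rw [h]
  nlinarith

theorem summable_X_pow_shiftedPronic_mul (j : ℕ) (a : ℕ → ℤ⟦X⟧) :
    Summable fun n => X ^ shiftedPronic j n * a n := by
  rw [← summable_nat_add_iff j]
  refine summable_of_X_pow_dvd fun n => (pow_dvd_pow _ ?_).mul_right _
  have := sub_le_shiftedPronic j (n + j)
  omega

/-- The series `∑_n q^{(n-j)(n-j+1)} / (q; q²)_{n+1}`. -/
noncomputable def shiftedNuSeries (j : ℕ) : ℤ⟦X⟧ :=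
  ∑' n, X ^ shiftedPronic j n * qPochInv (n + 1)

theorem hasSum_shiftedNuSeries (j : ℕ) :
    HasSum (fun n => X ^ shiftedPronic j n * qPochInv (n + 1)) (shiftedNuSeries j) :=
  (summable_X_pow_shiftedPronic_mul j _).hasSum

theorem shiftedNuSeries_zero : shiftedNuSeries 0 = rescale (-1 : ℤ) nuSeries := by
  refine (hasSum_shiftedNuSeries 0).unique (hasSum_nuPartsSeries_rescale.congr_fun fun n => ?_)
  rw [nuPartsSeries_eq]
  congr 2
  zify [coe_shiftedPronic]
  ring

/-- With b_n = q^((n-j-1)(n-j))/(q;q²)_n, the n-th term of S_{j+1} - (1+q^(2j+1)) S_j is b_n -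
b_{n+1}, so the sum telescopes to b_0 = q^(j²+j). -/
theorem shiftedNuSeries_succ (j : ℕ) :
    shiftedNuSeries (j + 1) = (1 + X ^ (2 * j + 1)) * shiftedNuSeries j + X ^ (j ^ 2 + j) := by
  obtain ⟨B, hB⟩ := summable_X_pow_shiftedPronic_mul (j + 1) qPochInv
  have h1 := hB.sub ((hasSum_nat_add_iff' 1).2 hB)
  have h2 := (hasSum_shiftedNuSeries (j + 1)).sub
    ((hasSum_shiftedNuSeries j).mul_left (1 + X ^ (2 * j + 1)))
  have h3 := h2.unique (h1.congr_fun fun n => ?_)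
  · have h4 : shiftedPronic (j + 1) 0 = j ^ 2 + j := by
      zify [coe_shiftedPronic]
      ring
    have h5 : qPochInv 0 = 1 := by simpa [qPoch] using qPoch_mul_qPochInv 0
    simp only [Finset.range_one, Finset.sum_singleton, h4, h5, mul_one] at h3
    linear_combination h3
  · rw [shiftedPronic_succ_succ, ← qPochInv_succ n]
    have h4 : (X : ℤ⟦X⟧) ^ shiftedPronic j n * X ^ (2 * j + 1) =
        X ^ shiftedPronic (j + 1) n * X ^ (2 * n + 1) := by
      rw [← pow_add, ← pow_add, shiftedPronic_add]
    linear_combination (-qPochInv (n + 1)) * h4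

/-- Dividing the recurrence by (-q;q²)_{j+1} turns its inhomogeneous term into the j-th term of
ν(q); this is how ν(q) joins ν(-q). -/
theorem shiftedNuSeries_eq (j : ℕ) : shiftedNuSeries j =
    qPoch (-X) (X ^ 2) j * (rescale (-1 : ℤ) nuSeries + ∑ i ∈ Finset.range j, nuTerm i) := by
  induction j with
  | zero => simp [shiftedNuSeries_zero, qPoch]
  | succ j ih =>
    have h1 : qPoch (-X : ℤ⟦X⟧) (X ^ 2) (j + 1) = qPoch (-X) (X ^ 2) j * (1 + X ^ (2 * j + 1)) := by
      rw [qPoch, Finset.prod_range_succ, ← qPoch, ← pow_mul]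
      ring
    have h2 : qPoch (-X : ℤ⟦X⟧) (X ^ 2) (j + 1) * nuTerm j = X ^ (j ^ 2 + j) := by
      rw [nuTerm, mul_left_comm, qPoch_mul_invOfUnit, mul_one]
    rw [shiftedNuSeries_succ, ih, Finset.sum_range_succ]
    rw [h1] at h2 ⊢
    linear_combination -h2

/-- The indices n ≥ j give the full series; those below j, reflected by n ↦ j-1-n, give the finite
sum. -/
theorem hasSum_X_pow_shiftedPronic (j : ℕ) : HasSum (fun n => (X : ℤ⟦X⟧) ^ shiftedPronic j n)
    (expand 2 two_ne_zero (triangularSeries fun _ => 1) +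
      ∑ i ∈ Finset.range j, X ^ (i * (i + 1))) := by
  have h : ∑ i ∈ Finset.range j, (X : ℤ⟦X⟧) ^ (i * (i + 1)) =
      ∑ n ∈ Finset.range j, X ^ shiftedPronic j n := by
    rw [← Finset.sum_range_reflect]
    refine Finset.sum_congr rfl fun i hi => ?_
    rw [Finset.mem_range] at hi
    congr 1
    zify [coe_shiftedPronic]
    rw [Nat.sub_sub, Nat.cast_sub (by omega)]
    push_cast
    ring
  rw [h, ← hasSum_nat_add_iff]
  refine hasSum_expand_triangularSeries_one.congr_fun fun n => ?_
  congr 1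
  zify [coe_shiftedPronic]
  ring

/-- The limit of (q;q²)_∞ S_j is found in two ways: termwise (`h1`), where both halves of the theta
series tend to ψ(q²), and through `shiftedNuSeries_eq` with (q;q²)_j (-q;q²)_j = (q²;q⁴)_j. -/
theorem expand_oddEulerSeries_mul_nuSeries :
    expand 2 two_ne_zero oddEulerSeries * (rescale (-1 : ℤ) nuSeries + nuSeries) =
      2 * expand 2 two_ne_zero (triangularSeries fun _ => 1) := by
  set ψ := expand 2 two_ne_zero (triangularSeries fun _ => 1) with hψ
  have h1 : Tendsto (fun j => oddEulerSeries * shiftedNuSeries j) atTop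
      (𝓝 (ψ + ψ)) := by
    refine tendsto_atTop_of_X_pow_dvd_sub
      (tendsto_const_nhds.add hasSum_expand_triangularSeries_one.tendsto_sum_nat)
      (e := fun j => 2 * j + 1)
      (tendsto_atTop_mono (fun j => show id j ≤ _ by rw [id]; omega) tendsto_id) fun j => ?_
    refine X_pow_dvd_of_hasSum (((hasSum_shiftedNuSeries j).mul_left oddEulerSeries).sub
      (hasSum_X_pow_shiftedPronic j)) fun n => ?_
    obtain ⟨u, hu⟩ := X_pow_dvd_oddEulerSeries_sub (n + 1)
    rw [sub_eq_iff_eq_add] at hu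
    have h2 := qPoch_mul_qPochInv (n + 1)
    have h3 : oddEulerSeries * (X ^ shiftedPronic j n * qPochInv (n + 1)) - X ^ shiftedPronic j n =
        X ^ (shiftedPronic j n + (2 * (n + 1) + 1)) * (u * qPochInv (n + 1)) := by
      rw [hu, pow_add]
      linear_combination X ^ shiftedPronic j n * h2
    rw [h3]
    exact (pow_dvd_pow _ (le_shiftedPronic_add j n)).mul_right _
  have h2 := (((continuous_expand two_ne_zero).tendsto _).comp tendsto_qPoch_X_sq).mul
    ((tendsto_const_nhds (x := rescale (-1 : ℤ) nuSeries)).add hasSum_nuTerm.tendsto_sum_nat)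
  rw [two_mul]
  refine tendsto_nhds_unique h2 (tendsto_atTop_of_X_pow_dvd_sub h1 (e := fun j => 2 * j + 1)
      (tendsto_atTop_mono (fun j => show id j ≤ _ by rw [id]; omega) tendsto_id) fun j => ?_)
  have h3 : expand 2 two_ne_zero (qPoch (X : ℤ⟦X⟧) (X ^ 2) j) =
      qPoch X (X ^ 2) j * qPoch (-X) (X ^ 2) j := by
    simp only [qPoch, map_prod, ← Finset.prod_mul_distrib, map_sub, map_mul, map_pow, map_one,
      expand_X]
    exact Finset.prod_congr rfl fun i _ => by ring
  rw [shiftedNuSeries_eq, Function.comp_apply, h3]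
  obtain ⟨u, hu⟩ := X_pow_dvd_oddEulerSeries_sub j
  rw [sub_eq_iff_eq_add] at hu
  refine ⟨-u * qPoch (-X) (X ^ 2) j *
    (rescale (-1 : ℤ) nuSeries + ∑ i ∈ Finset.range j, nuTerm i), ?_⟩
  rw [hu]
  ring

/-- The generating function of `pNu` at even arguments. -/
noncomputable def evenNuSeries : ℤ⟦X⟧ := PowerSeries.mk fun n => (pNu (2 * n) : ℤ)

theorem rescale_nuSeries_add_nuSeries :
    rescale (-1 : ℤ) nuSeries + nuSeries = 2 * expand 2 two_ne_zero evenNuSeries := by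
  ext N
  have h : coeff N (rescale (-1 : ℤ) nuSeries) = (-1) ^ N * coeff N nuSeries := coeff_rescale _ _ _
  have hN := coeff_rescale_nuSeries N
  rw [two_mul, map_add, map_add, coeff_expand]
  split_ifs with hd
  · obtain ⟨n, rfl⟩ := hd
    rw [pow_mul] at h
    rw [Nat.mul_div_cancel_left _ two_pos, evenNuSeries, coeff_mk, ← hN, h]
    simp
  · have : Odd N := Nat.not_even_iff_odd.1 fun h => hd h.two_dvd
    rw [h, this.neg_one_pow]
    simp

theorem oddEulerSeries_mul_evenNuSeries :
    oddEulerSeries * evenNuSeries = triangularSeries fun _ => 1 := by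
  have h := expand_oddEulerSeries_mul_nuSeries
  rw [rescale_nuSeries_add_nuSeries, mul_left_comm] at h
  have h0 : (2 : ℤ⟦X⟧) ≠ 0 := fun h => by
    have h := congrArg constantCoeff h
    rw [map_ofNat, map_zero] at h
    exact two_ne_zero h
  have h2 := mul_left_cancel₀ h0 h
  rw [← map_mul] at h2
  ext N
  rw [← coeff_expand_mul 2 two_ne_zero, h2, coeff_expand_mul]

/-! ### Gaussian binomials and the q-binomial theorem -/

/-- The Gaussian binomial coefficient, as a power series in `q = X`. -/
noncomputable def gaussBinom : ℕ → ℕ → ℤ⟦X⟧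
  | _, 0 => 1
  | 0, _ + 1 => 0
  | n + 1, k + 1 => X ^ (k + 1) * gaussBinom n (k + 1) + gaussBinom n k

theorem gaussBinom_zero_right (n : ℕ) : gaussBinom n 0 = 1 := by
  rw [gaussBinom]

theorem gaussBinom_succ_succ (n k : ℕ) :
    gaussBinom (n + 1) (k + 1) = X ^ (k + 1) * gaussBinom n (k + 1) + gaussBinom n k := by
  rw [gaussBinom]

theorem gaussBinom_eq_zero {n k : ℕ} (h : n < k) : gaussBinom n k = 0 := by
  induction n generalizing k with
  | zero =>
    obtain ⟨k, rfl⟩ := Nat.exists_eq_succ_of_ne_zero h.ne'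
    rw [gaussBinom]
  | succ n ih =>
    obtain ⟨k, rfl⟩ := Nat.exists_eq_succ_of_ne_zero (by omega : k ≠ 0)
    rw [Nat.succ_eq_add_one, gaussBinom_succ_succ, ih (by omega), ih (by omega), mul_zero, add_zero]

theorem qPoch_X_X_succ (n : ℕ) :
    qPoch (X : ℤ⟦X⟧) X (n + 1) = qPoch X X n * (1 - X ^ (n + 1)) := by
  rw [qPoch, Finset.prod_range_succ, ← qPoch, pow_succ']

theorem gaussBinom_mul_qPoch (a b : ℕ) :
    gaussBinom (a + b) a * qPoch X X a * qPoch X X b = qPoch X X (a + b) := by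
  induction h : a + b generalizing a b with
  | zero =>
    obtain ⟨rfl, rfl⟩ : a = 0 ∧ b = 0 := by omega
    simp [gaussBinom, qPoch]
  | succ n ih =>
    rcases a with _ | a
    · rw [← h]
      simp [gaussBinom_zero_right, qPoch]
    · obtain rfl : n = a + b := by omega
      have h1 := ih a b rfl
      rw [gaussBinom_succ_succ, qPoch_X_X_succ a, qPoch_X_X_succ (a + b)]
      rcases b with _ | b
      · rw [gaussBinom_eq_zero (by omega)]
        simp only [add_zero] at h1 ⊢
        linear_combination (1 - X ^ (a + 1)) * h1
      · have h2 := ih (a + 1) b (by omega)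
        rw [qPoch_X_X_succ a] at h2
        rw [qPoch_X_X_succ b] at h1 ⊢
        linear_combination (1 - X ^ (a + 1)) * h1 + X ^ (a + 1) * (1 - X ^ (b + 1)) * h2

theorem constantCoeff_qPoch_X_X (n : ℕ) : constantCoeff (qPoch (X : ℤ⟦X⟧) X n) = 1 := by
  simp [qPoch, map_prod]

theorem qPoch_X_X_ne_zero (n : ℕ) : qPoch (X : ℤ⟦X⟧) X n ≠ 0 := fun h => by
  simpa [h] using constantCoeff_qPoch_X_X n

theorem gaussBinom_symm (a b : ℕ) : gaussBinom (a + b) a = gaussBinom (a + b) b := by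
  apply mul_right_cancel₀ (mul_ne_zero (qPoch_X_X_ne_zero a) (qPoch_X_X_ne_zero b))
  have h := gaussBinom_mul_qPoch b a
  rw [add_comm b a] at h
  linear_combination gaussBinom_mul_qPoch a b - h

/-- The `q`-binomial theorem. -/
theorem prod_add_mul_pow_eq_sum_gaussBinom {A : Type*} [CommRing A] [Algebra ℤ⟦X⟧ A] (n : ℕ)
    (x y : A) : ∏ i ∈ Finset.range n, (x + y * algebraMap ℤ⟦X⟧ A X ^ i) =
      ∑ k ∈ Finset.range (n + 1), algebraMap ℤ⟦X⟧ A (gaussBinom n k * X ^ (k.choose 2)) *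
        y ^ k * x ^ (n - k) := by
  induction n generalizing y with
  | zero => simp [gaussBinom]
  | succ n ih =>
    have h1 := ih (y * algebraMap ℤ⟦X⟧ A X)
    have h2 : ∏ i ∈ Finset.range n, (x + y * algebraMap ℤ⟦X⟧ A X ^ (i + 1)) =
        ∏ i ∈ Finset.range n, (x + y * algebraMap ℤ⟦X⟧ A X * algebraMap ℤ⟦X⟧ A X ^ i) :=
      Finset.prod_congr rfl fun i _ => by ring
    rw [Finset.prod_range_succ', pow_zero, mul_one, h2, h1, mul_add]
    have h3 : ∑ k ∈ Finset.range (n + 1), algebraMap ℤ⟦X⟧ A (gaussBinom (n + 1) (k + 1) *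
          X ^ ((k + 1).choose 2)) * y ^ (k + 1) * x ^ (n + 1 - (k + 1)) =
        ∑ k ∈ Finset.range (n + 1), algebraMap ℤ⟦X⟧ A (X ^ (k + 1) * gaussBinom n (k + 1) *
          X ^ ((k + 1).choose 2)) * y ^ (k + 1) * x ^ (n - k) +
        ∑ k ∈ Finset.range (n + 1), algebraMap ℤ⟦X⟧ A (gaussBinom n k *
          X ^ ((k + 1).choose 2)) * y ^ (k + 1) * x ^ (n - k) := by
      rw [← Finset.sum_add_distrib]
      refine Finset.sum_congr rfl fun k _ => ?_
      rw [gaussBinom_succ_succ, Nat.add_sub_add_right, add_mul, map_add]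
      ring
    have h4 : x * ∑ k ∈ Finset.range (n + 1), algebraMap ℤ⟦X⟧ A (gaussBinom n k *
          X ^ (k.choose 2)) * (y * algebraMap ℤ⟦X⟧ A X) ^ k * x ^ (n - k) =
        ∑ k ∈ Finset.range (n + 2), algebraMap ℤ⟦X⟧ A (gaussBinom n k *
          X ^ ((k + 1).choose 2)) * y ^ k * x ^ (n + 1 - k) := by
      rw [Finset.sum_range_succ _ (n + 1), gaussBinom_eq_zero (Nat.lt_succ_self n), zero_mul,
        map_zero, zero_mul, zero_mul, add_zero, Finset.mul_sum]
      refine Finset.sum_congr rfl fun k hk => ?_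
      rw [Finset.mem_range] at hk
      rw [Nat.choose_succ_succ' k 1, Nat.choose_one_right, show n + 1 - k = n - k + 1 by omega]
      simp only [map_mul, map_pow]
      ring
    rw [mul_comm _ x, h4, Finset.sum_range_succ', Finset.sum_range_succ' _ (n + 1), h3]
    have h5 : ∀ k, (k + 1 + 1).choose 2 = k + 1 + (k + 1).choose 2 := fun k => by
      rw [Nat.choose_succ_succ' (k + 1) 1, Nat.choose_one_right]
    have h6 : ∀ k, (k + 1).choose 2 = k + k.choose 2 := fun k => by
      rw [Nat.choose_succ_succ' k 1, Nat.choose_one_right]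
    have h7 : ∑ k ∈ Finset.range (n + 1), algebraMap ℤ⟦X⟧ A (gaussBinom n (k + 1) *
          X ^ ((k + 1 + 1).choose 2)) * y ^ (k + 1) * x ^ (n + 1 - (k + 1)) =
        ∑ k ∈ Finset.range (n + 1), algebraMap ℤ⟦X⟧ A (X ^ (k + 1) * gaussBinom n (k + 1) *
          X ^ ((k + 1).choose 2)) * y ^ (k + 1) * x ^ (n - k) := by
      refine Finset.sum_congr rfl fun k _ => ?_
      rw [h5, Nat.add_sub_add_right]
      simp only [map_mul, map_pow]
      ring
    have h8 : y * ∑ k ∈ Finset.range (n + 1), algebraMap ℤ⟦X⟧ A (gaussBinom n k *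
          X ^ (k.choose 2)) * (y * algebraMap ℤ⟦X⟧ A X) ^ k * x ^ (n - k) =
        ∑ k ∈ Finset.range (n + 1), algebraMap ℤ⟦X⟧ A (gaussBinom n k *
          X ^ ((k + 1).choose 2)) * y ^ (k + 1) * x ^ (n - k) := by
      rw [Finset.mul_sum]
      refine Finset.sum_congr rfl fun k _ => ?_
      rw [h6]
      simp only [map_mul, map_pow]
      ring
    rw [h7, mul_comm _ y, h8]
    simp only [gaussBinom_zero_right, zero_add, show Nat.choose 1 2 = 0 from rfl,
      show Nat.choose 0 2 = 0 from rfl]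
    ring

theorem two_mul_choose_two (n : ℕ) : 2 * n.choose 2 + n = n * n := by
  induction n with
  | zero => rfl
  | succ n ih =>
    rw [Nat.choose_succ_succ' n 1, Nat.choose_one_right]
    linarith

/-! ### Finite triple product and two specializations -/

/-- A finite form of the Jacobi triple product. -/
theorem prod_eq_sum_gaussBinom (n : ℕ) :
    (1 + Polynomial.X) * (∏ i ∈ Finset.range n, (1 + Polynomial.X * Polynomial.C (X ^ (i + 1)))) *
      ∏ i ∈ Finset.range n, (Polynomial.X + Polynomial.C (X ^ (i + 1))) =
    ∑ j ∈ Finset.range (n + 1), Polynomial.C (gaussBinom (2 * n + 1) (n - j) *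
      (X : ℤ⟦X⟧) ^ (j * (j + 1) / 2)) * (Polynomial.X ^ (n - j) + Polynomial.X ^ (n + 1 + j)) := by
  -- The q-binomial theorem with 2n+1 factors q^n + z q^i is used. The power of q pulled out
  -- collects n choose 2 from i < n, n from i = n and n² from i > n.
  have hC : Polynomial.C ((X : ℤ⟦X⟧) ^ (n.choose 2 + n + n * n)) ≠ 0 := by
    rw [Ne, Polynomial.C_eq_zero]
    exact pow_ne_zero _ X_ne_zero
  apply mul_left_cancel₀ hC
  have h := prod_add_mul_pow_eq_sum_gaussBinom (A := Polynomial ℤ⟦X⟧) (2 * n + 1)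
    (Polynomial.C (X ^ n)) Polynomial.X
  simp only [Polynomial.algebraMap_eq] at h
  have hl : ∏ i ∈ Finset.range (2 * n + 1),
      (Polynomial.C ((X : ℤ⟦X⟧) ^ n) + Polynomial.X * Polynomial.C X ^ i) =
      Polynomial.C ((X : ℤ⟦X⟧) ^ (n.choose 2 + n + n * n)) * ((1 + Polynomial.X) *
        (∏ i ∈ Finset.range n, (1 + Polynomial.X * Polynomial.C (X ^ (i + 1)))) *
        ∏ i ∈ Finset.range n, (Polynomial.X + Polynomial.C (X ^ (i + 1)))) := by
    have h1 : ∏ i ∈ Finset.range n,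
        (Polynomial.C ((X : ℤ⟦X⟧) ^ n) + Polynomial.X * Polynomial.C X ^ i) =
        Polynomial.C (X ^ n.choose 2) *
          ∏ i ∈ Finset.range n, (Polynomial.X + Polynomial.C (X ^ (i + 1))) := by
      rw [← Finset.prod_range_reflect (fun i => Polynomial.X + Polynomial.C ((X : ℤ⟦X⟧) ^ (i + 1))),
        Nat.choose_two_right, ← Finset.sum_range_id, ← Finset.prod_pow_eq_pow_sum, map_prod,
        ← Finset.prod_mul_distrib]
      refine Finset.prod_congr rfl fun i hi => ?_
      rw [Finset.mem_range] at hi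
      obtain ⟨a, rfl⟩ : ∃ a, n = i + (a + 1) := ⟨n - 1 - i, by omega⟩
      rw [show i + (a + 1) - 1 - i = a by omega]
      simp only [pow_add, map_mul, map_pow]
      ring
    have h2 : ∏ i ∈ Finset.range n,
        (Polynomial.C ((X : ℤ⟦X⟧) ^ n) + Polynomial.X * Polynomial.C X ^ (n + 1 + i)) =
        Polynomial.C (X ^ (n * n)) *
          ∏ i ∈ Finset.range n, (1 + Polynomial.X * Polynomial.C (X ^ (i + 1))) := by
      have h3 := Finset.prod_const (s := Finset.range n) (Polynomial.C ((X : ℤ⟦X⟧) ^ n))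
      rw [Finset.card_range, ← map_pow, ← pow_mul] at h3
      rw [← h3, ← Finset.prod_mul_distrib]
      refine Finset.prod_congr rfl fun i _ => ?_
      simp only [pow_add, map_mul, map_pow]
      ring
    rw [show 2 * n + 1 = n + 1 + n by ring, Finset.prod_range_add, Finset.prod_range_succ, h1, h2]
    simp only [pow_add, map_mul, map_pow]
    ring
  -- Fold the sum about its centre: the indices n-j and n+1+j carry equal Gaussian binomials.
  rw [← hl, h, show 2 * n + 1 + 1 = (n + 1) + (n + 1) by ring, Finset.sum_range_add,
    ← Finset.sum_range_reflect, ← Finset.sum_add_distrib, Finset.mul_sum]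
  refine Finset.sum_congr rfl fun j hj => ?_
  rw [Finset.mem_range] at hj
  obtain ⟨a, rfl⟩ : ∃ a, n = a + j := ⟨n - j, by omega⟩
  have hg : gaussBinom (2 * (a + j) + 1) (a + j + 1 + j) = gaussBinom (2 * (a + j) + 1) a := by
    have := gaussBinom_symm a (a + j + 1 + j)
    rw [show a + (a + j + 1 + j) = 2 * (a + j) + 1 by ring] at this
    exact this.symm
  rw [show a + j + 1 - 1 - j = a by omega, show a + j - j = a by omega, hg,
    show 2 * (a + j) + 1 - a = a + 2 * j + 1 by omega,
    show 2 * (a + j) + 1 - (a + j + 1 + j) = a by omega]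
  have ht : j * (j + 1) / 2 = j.choose 2 + j := by
    have := two_mul_choose_two j
    rw [mul_add]; omega
  have h1 := two_mul_choose_two a
  have h2 := two_mul_choose_two j
  have h3 := two_mul_choose_two (a + j)
  have h4 := two_mul_choose_two (a + j + 1 + j)
  have e1 : a.choose 2 + (a + j) * (a + 2 * j + 1) =
      (a + j).choose 2 + (a + j) + (a + j) * (a + j) + j * (j + 1) / 2 := by
    rw [ht]
    linarith
  have e2 : (a + j + 1 + j).choose 2 + (a + j) * a =
      (a + j).choose 2 + (a + j) + (a + j) * (a + j) + j * (j + 1) / 2 := by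
    rw [ht]
    linarith
  have f1 := congrArg (fun e => (Polynomial.C (X : ℤ⟦X⟧)) ^ e) e1
  have f2 := congrArg (fun e => (Polynomial.C (X : ℤ⟦X⟧)) ^ e) e2
  simp only [pow_add _ _ (_ / 2), pow_add _ _ (_ * _)] at f1 f2
  simp only [map_mul, map_pow, ← pow_mul]
  linear_combination Polynomial.C (gaussBinom (2 * (a + j) + 1) a) * (Polynomial.X ^ a * f1 +
    Polynomial.X ^ (a + j + 1 + j) * f2)

/-- Put z = 1 in the finite triple product and cancel the factor 2 on both sides. -/
theorem prod_one_add_sq_eq_sum (n : ℕ) :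
    (∏ i ∈ Finset.range n, (1 + (X : ℤ⟦X⟧) * X ^ i)) ^ 2 =
      ∑ j ∈ Finset.range (n + 1), C (1 : ℤ) * gaussBinom (2 * n + 1) (n - j) *
        X ^ (j * (j + 1) / 2) := by
  have h := congrArg (Polynomial.eval 1) (prod_eq_sum_gaussBinom n)
  simp only [Polynomial.eval_mul, Polynomial.eval_add, Polynomial.eval_one, Polynomial.eval_X,
    Polynomial.eval_prod, Polynomial.eval_C, Polynomial.eval_finsetSum, Polynomial.eval_pow,
    one_pow, one_mul, ← Finset.sum_mul, pow_succ'] at h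
  have h0 : (1 + 1 : ℤ⟦X⟧) ≠ 0 := fun h => by
    have h := congrArg constantCoeff h
    rw [map_add, map_one, map_zero] at h
    exact absurd h (by norm_num)
  apply mul_left_cancel₀ h0
  simp only [map_one, one_mul]
  linear_combination h

/-- Differentiate the finite triple product at z = -1: the factor 1+z vanishes there, so only its
own derivative survives on the left, while on the right the exponents n-j and n+1+j leave the weight
2j+1. -/
theorem qPoch_sq_eq_sum (n : ℕ) :
    qPoch (X : ℤ⟦X⟧) X n ^ 2 = ∑ j ∈ Finset.range (n + 1),
      C ((-1) ^ j * (2 * j + 1) : ℤ) * gaussBinom (2 * n + 1) (n - j) *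
        X ^ (j * (j + 1) / 2) := by
  have h := congrArg (fun p => Polynomial.eval (-1) (Polynomial.derivative p))
    (prod_eq_sum_gaussBinom n)
  simp only [mul_assoc (1 + Polynomial.X : Polynomial ℤ⟦X⟧),
    Polynomial.derivative_mul (f := (1 + Polynomial.X : Polynomial ℤ⟦X⟧)),
    Polynomial.derivative_sum, Polynomial.derivative_C_mul, Polynomial.derivative_X_pow,
    Polynomial.derivative_add, Polynomial.derivative_one, Polynomial.derivative_X,
    Polynomial.eval_mul, Polynomial.eval_add, Polynomial.eval_one, Polynomial.eval_X,
    Polynomial.eval_prod, Polynomial.eval_C, Polynomial.eval_finsetSum, Polynomial.eval_pow,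
    zero_add, one_mul, add_neg_cancel, zero_mul, add_zero] at h
  have h1 : ∏ i ∈ Finset.range n, (1 + -1 * (X : ℤ⟦X⟧) ^ (i + 1)) = qPoch X X n :=
    Finset.prod_congr rfl fun i _ => by ring
  have h2 : ∏ i ∈ Finset.range n, (-1 + (X : ℤ⟦X⟧) ^ (i + 1)) = (-1) ^ n * qPoch X X n := by
    rw [qPoch, ← Finset.card_range n, ← Finset.prod_const, Finset.card_range,
      ← Finset.prod_mul_distrib]
    exact Finset.prod_congr rfl fun i _ => by ring
  have h3 : ((-1) ^ n * (-1) ^ n : ℤ⟦X⟧) = 1 := by rw [← mul_pow]; simp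
  rw [h1, h2] at h
  have h4 : qPoch (X : ℤ⟦X⟧) X n ^ 2 =
      (-1) ^ n * (qPoch X X n * ((-1) ^ n * qPoch X X n)) := by
    linear_combination (-qPoch (X : ℤ⟦X⟧) X n ^ 2) * h3
  rw [h4, h, Finset.mul_sum]
  refine Finset.sum_congr rfl fun j hj => ?_
  obtain ⟨a, rfl⟩ : ∃ a, n = a + j := ⟨n - j, by rw [Finset.mem_range] at hj; omega⟩
  rw [show a + j - j = a by omega, show a + j + 1 + j - 1 = a + j + j by omega]
  have hc : (C ((-1) ^ j * (2 * j + 1) : ℤ) : ℤ⟦X⟧) = (-1) ^ j * (2 * j + 1) := by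
    simp
  have ha : ((a : ℤ⟦X⟧)) * (-1) ^ (a - 1) = -(a * (-1) ^ a) := by
    rcases a with _ | a
    · simp
    · rw [Nat.add_sub_cancel, pow_succ]; ring
  have e1 : ((-1) ^ a * (-1) ^ a : ℤ⟦X⟧) = 1 := by rw [← mul_pow]; simp
  have e2 : ((-1) ^ j * (-1) ^ j : ℤ⟦X⟧) = 1 := by rw [← mul_pow]; simp
  rw [hc]
  simp only [pow_add, ha]
  push_cast
  linear_combination gaussBinom (2 * (a + j) + 1) a * X ^ (j * (j + 1) / 2) *
    ((-a * (-1) ^ j + (a + 2 * j + 1) * ((-1) ^ j) ^ 3) * e1 + (a + 2 * j + 1) * (-1) ^ j * e2)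

/-! ### The limiting identities of Gauss and Jacobi -/

theorem constantCoeff_eulerSeries : constantCoeff eulerSeries = 1 := by
  have h := X_pow_dvd_iff.1 (X_pow_dvd_eulerSeries_sub 0) 0 (by omega)
  rw [map_sub, sub_eq_zero] at h
  simpa [qPoch] using h

theorem isUnit_eulerSeries : IsUnit eulerSeries := by
  rw [isUnit_iff_constantCoeff, constantCoeff_eulerSeries]; exact isUnit_one

/-- In (q;q)_{a+b} / ((q;q)_a (q;q)_b) all three products agree with (q;q)_∞ below q^(a+1), so the
quotient is 1/(q;q)_∞ to that order. -/
theorem X_pow_dvd_gaussBinom_mul_eulerSeries_sub {a b : ℕ} (h : a ≤ b) :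
    X ^ (a + 1) ∣ gaussBinom (a + b) a * eulerSeries - 1 := by
  have hd (n : ℕ) (hn : a ≤ n) : X ^ (a + 1) ∣ eulerSeries - qPoch X X n :=
    (pow_dvd_pow _ (by omega)).trans (X_pow_dvd_eulerSeries_sub n)
  obtain ⟨u, hu⟩ := hd a le_rfl
  obtain ⟨v, hv⟩ := hd b h
  obtain ⟨w, hw⟩ := hd (a + b) (by omega)
  have hg := gaussBinom_mul_qPoch a b
  rw [← isUnit_eulerSeries.dvd_mul_left]
  refine ⟨gaussBinom (a + b) a * (u * eulerSeries + v * qPoch X X a) - w, ?_⟩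
  linear_combination hg - hw + gaussBinom (a + b) a * (eulerSeries * hu + qPoch X X a * hv)

theorem tendsto_sum_gaussBinom_mul_eulerSeries (c : ℕ → ℤ) :
    Tendsto (fun n => (∑ j ∈ Finset.range (n + 1), C (c j) * gaussBinom (2 * n + 1) (n - j) *
      X ^ (j * (j + 1) / 2)) * eulerSeries) atTop (𝓝 (triangularSeries c)) := by
  refine tendsto_atTop_of_X_pow_dvd_sub ((hasSum_triangularSeries c).tendsto_sum_nat.comp
    (tendsto_add_atTop_nat 1)) tendsto_id fun n => ?_
  rw [Function.comp_apply, Finset.sum_mul, ← Finset.sum_sub_distrib]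
  refine Finset.dvd_sum fun j hj => ?_
  rw [Finset.mem_range] at hj
  have h := X_pow_dvd_gaussBinom_mul_eulerSeries_sub (a := n - j) (b := n + 1 + j) (by omega)
  rw [show n - j + (n + 1 + j) = 2 * n + 1 by omega] at h
  have h2 := mul_dvd_mul (dvd_refl ((X : ℤ⟦X⟧) ^ (j * (j + 1) / 2))) h
  rw [← pow_add] at h2
  -- The error has order at least j(j+1)/2 + (n-j+1), which exceeds n for every j ≤ n.
  have h3 := le_triangular j
  refine ((pow_dvd_pow _ (show id n ≤ _ by rw [id]; omega)).trans h2).trans ⟨C (c j), ?_⟩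
  ring

/-- Gauss's identity for the triangular numbers. -/
theorem triangularSeries_one_mul_eulerSeries :
    (triangularSeries fun _ => 1) * eulerSeries = expand 2 two_ne_zero eulerSeries ^ 2 := by
  have hM := tendsto_prod_one_add (f := fun n => (X : ℤ⟦X⟧) * X ^ n) fun n => dvd_mul_left _ _
  set M := ∏' n : ℕ, (1 + (X : ℤ⟦X⟧) * X ^ n) with hMdef
  have h1 : M ^ 2 * eulerSeries = triangularSeries fun _ => 1 :=
    tendsto_nhds_unique (((hM.pow 2).mul tendsto_const_nhds).congr fun n => by
      rw [prod_one_add_sq_eq_sum]) (tendsto_sum_gaussBinom_mul_eulerSeries fun _ => 1)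
  have h2 : M * eulerSeries = expand 2 two_ne_zero eulerSeries := by
    refine tendsto_nhds_unique ((hM.mul tendsto_qPoch_X_X).congr fun n => ?_)
      (((continuous_expand two_ne_zero).tendsto _).comp tendsto_qPoch_X_X)
    simp only [qPoch, Function.comp_apply, map_prod, ← Finset.prod_mul_distrib, map_sub, map_mul,
      map_pow, map_one, expand_X]
    exact Finset.prod_congr rfl fun i _ => by ring
  rw [← h1, ← h2]
  ring

/-- Jacobi's identity for the cube of the Euler product. -/
theorem eulerSeries_pow_three :
    eulerSeries ^ 3 = triangularSeries fun j => (-1) ^ j * (2 * j + 1) := by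
  have h : Tendsto (fun n => qPoch (X : ℤ⟦X⟧) X n ^ 2 * eulerSeries) atTop
      (𝓝 (eulerSeries ^ 2 * eulerSeries)) := (tendsto_qPoch_X_X.pow 2).mul tendsto_const_nhds
  rw [pow_succ]
  exact tendsto_nhds_unique (h.congr fun n => by rw [qPoch_sq_eq_sum])
    (tendsto_sum_gaussBinom_mul_eulerSeries _)

/-! ### The congruence modulo 5 -/

theorem evenNuSeries_mul_eulerSeries_sq :
    evenNuSeries * eulerSeries ^ 2 = expand 2 two_ne_zero eulerSeries ^ 3 := by
  have h1 := oddEulerSeries_mul_evenNuSeries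
  have h2 := oddEulerSeries_mul_expand_eulerSeries
  have h3 := triangularSeries_one_mul_eulerSeries
  linear_combination expand 2 two_ne_zero eulerSeries * (h3 + eulerSeries * h1) -
    evenNuSeries * eulerSeries * h2

theorem evenNuSeries_mul_eulerSeries_pow_five :
    evenNuSeries * eulerSeries ^ 5 = (triangularSeries fun j => (-1) ^ j * (2 * j + 1)) *
      expand 2 two_ne_zero (triangularSeries fun j => (-1) ^ j * (2 * j + 1)) := by
  rw [← eulerSeries_pow_three, map_pow]
  linear_combination eulerSeries ^ 3 * evenNuSeries_mul_eulerSeries_sq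

/-- A contributing j has 8N+1 = (2j+1)². Squares modulo 5 are 0 and ±1, so excluding ±1 forces 5 to
divide the weight 2j+1. -/
theorem five_dvd_coeff_jacobi {N : ℕ}
    (h : ((8 * N + 1 : ℕ) : ZMod 5) ≠ 1 ∧ ((8 * N + 1 : ℕ) : ZMod 5) ≠ -1) :
    ((coeff N (triangularSeries fun j => (-1) ^ j * (2 * j + 1)) : ℤ) : ZMod 5) = 0 := by
  rw [coeff_triangularSeries, Int.cast_sum]
  refine Finset.sum_eq_zero fun j _ => ?_
  split_ifs with hN
  · have h1 : 8 * N + 1 = (2 * j + 1) ^ 2 := by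
      have := Nat.mul_div_cancel' (Nat.even_mul_succ_self j).two_dvd
      rw [hN]
      linarith
    rw [h1] at h
    push_cast at h ⊢
    have key : ∀ x : ZMod 5, x ^ 2 ≠ 1 ∧ x ^ 2 ≠ -1 → x = 0 := by decide
    rw [key _ h, mul_zero]
  · simp

/-- If a + 2c ≡ 4, then (8a+1) + 2(8c+1) ≡ 0 modulo 5, which is impossible with both brackets ±1; so
one of the two factors vanishes. -/
theorem five_dvd_coeff_jacobi_mul_jacobi (n : ℕ) :
    ((coeff (5 * n + 4) ((triangularSeries fun j => (-1) ^ j * (2 * j + 1)) *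
      expand 2 two_ne_zero (triangularSeries fun j => (-1) ^ j * (2 * j + 1))) : ℤ) : ZMod 5) =
      0 := by
  rw [coeff_mul, Int.cast_sum]
  refine Finset.sum_eq_zero fun p hp => ?_
  rw [Finset.HasAntidiagonal.mem_antidiagonal] at hp
  rw [coeff_expand, Int.cast_mul]
  split_ifs with hd
  · obtain ⟨c, hc⟩ := hd
    rw [hc, Nat.mul_div_cancel_left _ two_pos]
    by_contra hne
    have h1 := mt five_dvd_coeff_jacobi (left_ne_zero_of_mul hne)
    have h2 := mt five_dvd_coeff_jacobi (right_ne_zero_of_mul hne)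
    have h3 : ((p.1 + 2 * c : ℕ) : ZMod 5) = ((5 * n + 4 : ℕ) : ZMod 5) := by rw [← hp, hc]
    push_cast at h1 h2 h3
    have h5 : (5 : ZMod 5) = 0 := rfl
    rw [h5, zero_mul, zero_add] at h3
    generalize (p.1 : ZMod 5) = x at *
    generalize (c : ZMod 5) = y at *
    have key : ∀ x y : ZMod 5, x + 2 * y = 4 → (8 * x + 1 ≠ 1 ∧ 8 * x + 1 ≠ -1) ∨
        (8 * y + 1 ≠ 1 ∧ 8 * y + 1 ≠ -1) := by decide
    rcases key x y h3 with h | h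
    · exact h1 h
    · exact h2 h
  · simp

/-- Multiplication by 1/g(q^p) moves exponents only by multiples of p, so vanishing on a residue
class survives the division. -/
theorem coeff_eq_zero_of_mul_expand {R : Type*} [Field R] {p r : ℕ} (hp : p ≠ 0) (hr : r < p)
    {f g : R⟦X⟧} (hg : constantCoeff g ≠ 0)
    (h : ∀ n, coeff (p * n + r) (f * expand p hp g) = 0) (n : ℕ) : coeff (p * n + r) f = 0 := by
  have h1 : f = f * expand p hp g * expand p hp g⁻¹ := by
    rw [mul_assoc, ← map_mul, PowerSeries.mul_inv_cancel _ hg, map_one, mul_one]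
  rw [h1, coeff_mul]
  refine Finset.sum_eq_zero fun x hx => ?_
  rw [Finset.HasAntidiagonal.mem_antidiagonal] at hx
  rw [coeff_expand p hp]
  split_ifs with hd
  · obtain ⟨c, hc⟩ := hd
    have hcn : c ≤ n := by
      by_contra hlt
      have := Nat.mul_le_mul_left p (show n + 1 ≤ c by omega)
      rw [mul_add] at this
      omega
    have h2 : x.1 = p * (n - c) + r := by
      have := Nat.mul_le_mul_left p hcn
      rw [Nat.mul_sub]
      omega
    rw [h2, h, zero_mul]
  · rw [mul_zero]

theorem five_dvd_pNu (n : ℕ) : 5 ∣ pNu (10 * n + 8) := by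
  have : Fact (Nat.Prime 5) := ⟨Nat.prime_five⟩
  let φ := PowerSeries.map (Int.castRingHom (ZMod 5))
  -- In characteristic 5 the fifth power raises q and the coefficients to the fifth power, and
  -- Frobenius is the identity on `ZMod 5`.
  have h1 : φ eulerSeries ^ 5 = expand 5 (by norm_num) (φ eulerSeries) := by
    have h := MvPowerSeries.map_frobenius_expand 5 (by norm_num) (f := φ eulerSeries)
    rw [ZMod.frobenius_zmod] at h
    rw [← h]
    ext n
    exact coeff_map _ _ _
  have h2 : coeff (5 * n + 4) (φ evenNuSeries) = 0 := by
    refine coeff_eq_zero_of_mul_expand (g := φ eulerSeries) (by norm_num) (by norm_num) ?_ ?_ n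
    · rw [← coeff_zero_eq_constantCoeff_apply, coeff_map, coeff_zero_eq_constantCoeff_apply,
        constantCoeff_eulerSeries, map_one]
      exact one_ne_zero
    · intro m
      rw [← h1, ← map_pow, ← map_mul, evenNuSeries_mul_eulerSeries_pow_five, coeff_map]
      exact five_dvd_coeff_jacobi_mul_jacobi m
  rw [coeff_map, evenNuSeries, coeff_mk, show 2 * (5 * n + 4) = 10 * n + 8 by ring] at h2
  simp only [eq_intCast, Int.cast_natCast] at h2
  exact (ZMod.natCast_eq_zero_iff _ _).1 h2

/-- `PowerSeries.rescale (-1) nuSeries` is `ν(-q)`. -/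
theorem theorem6p6 :
    (∀ n : ℕ, sptNu (10 * n + 8) = pNu (10 * n + 8) ∧
      sptNu (10 * n + 8) ≡ 0 [MOD 5] ∧ pNu (10 * n + 8) ≡ 0 [MOD 5]) ∧
    (∀ n : ℕ, (5 : ℤ) ∣
      PowerSeries.coeff (10 * n + 8) (PowerSeries.rescale (-1 : ℤ) nuSeries)) := by
  refine ⟨fun n => ?_, fun n => ?_⟩
  · have h := Nat.modEq_zero_iff_dvd.2 (five_dvd_pNu n)
    exact ⟨sptNu_eq_pNu _, sptNu_eq_pNu _ ▸ h, h⟩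
  · rw [coeff_rescale_nuSeries]
    exact_mod_cast five_dvd_pNu n
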